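/- All graphs are finite and simple. For a graph $G=(V,E)$ let $G'$ be the graph with the following vertices and edges: two vertices $x_v,y_v$ for every $v\in V$; four vertices $p_{e,u},q_{e,u},p_{e,v},q_{e,v}$ for every edge $e=uv\in E$; an edge $x_vy_u$ for all $u,v\in V$ (including $u=v$); and, for every edge $e=uv\in E$, the edges $p_{e,u}q_{e,u}$, $p_{e,v}q_{e,v}$, $x_up_{e,u}$, $y_vq_{e,u}$, $x_vp_{e,v}$, $y_uq_{e,v}$. A branch decomposition of a graph $H$ is a finite tree $T$ of maximum degree at most $3$ together with a bijection between $V(H)$ and the set of leaves of $T$ (the vertex of a one-vertex tree counts as a leaf). Root $T$ at any node; each node $t$ gives the cut $(X_t,\overline{X_t})$ of $V(H)$, where $X_t$ is the set of vertices of $H$ assigned to the leaves in the subtree of $T$ rooted in $t$ and $\overline{X_t}=V(H)\setminus X_t$. For a cut $(X,\overline X)$ let $H[X,\overline X]$ be the graph on $V(H)$ whose edges are the edges of $H$ with one end in $X$ and the other in $\overline X$. The MIM-width $\mathbf{mimw}(H)$ is the minimum, over all branch decompositions of $H$, of the maximum, over all nodes $t$, of the size of a maximum induced matching of $H[X_t,\overline{X_t}]$.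 Let $\mathbf{tw}(G)$ denote the treewidth of $G$. (For the graph without vertices both widths are taken to be $0$.) Then for every bipartite graph $G$, $$\mathbf{tw}(G)\le 6\,\mathbf{mimw}(G').$$ -/

import Mathlib

namespace GraphWidth

/-- A tree decomposition of a graph `G`, indexed by the nodes of a finite tree. -/
structure TreeDecomposition {V : Type*} (G : SimpleGraph V) where
  /-- The nodes of the tree. -/
  Node : Type
  finite_node : Finite Node
  tree : SimpleGraph Node
  isTree : tree.IsTree
  bag : Node → Set V
  /-- Every vertex lies in some bag. -/
  exists_mem_bag : ∀ v : V, ∃ t, v ∈ bag t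
  /-- Both ends of every edge lie in a common bag. -/
  exists_edge_bag : ∀ u v : V, G.Adj u v → ∃ t, u ∈ bag t ∧ v ∈ bag t
  /-- The nodes whose bags contain a given vertex induce a connected subtree. -/
  bag_preconnected : ∀ v : V, (tree.induce {t | v ∈ bag t}).Preconnected

/-- The treewidth of a finite graph: the least `k` such that some tree decomposition has only bags
with at most `k + 1` vertices. -/
noncomputable def treewidth {V : Type*} (G : SimpleGraph V) : ℕ :=
  sInf {k | ∃ D : TreeDecomposition G, ∀ t, (D.bag t).ncard ≤ k + 1}

/-- The leaves of a tree: the vertices of degree at most one. (Degree zero occurs only in the tree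
with a single vertex, which is then a leaf.) -/
def leaves {N : Type*} (T : SimpleGraph N) : Set N :=
  {t | (T.neighborSet t).ncard ≤ 1}

/-- A (rooted) branch decomposition of a graph with vertex set `V`: a finite tree of maximum degree
at most three, with a distinguished root, and a bijection between `V` and its leaves. -/
structure BranchDecomposition (V : Type*) where
  /-- The nodes of the tree. -/
  Node : Type
  finite_node : Finite Node
  tree : SimpleGraph Node
  isTree : tree.IsTree
  subcubic : ∀ t, (tree.neighborSet t).ncard ≤ 3
  root : Node
  leafEquiv : V ≃ leaves tree

namespace BranchDecomposition

variable {V : Type*} (D : BranchDecomposition V)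

/-- The nodes of the subtree `T_x` rooted in `x`: those `y` that are separated from the root by `x`
(with `x` itself included). -/
def subtree (x : D.Node) : Set D.Node :=
  {y | ∀ p : D.tree.Walk D.root y, x ∈ p.support}

/-- The vertices of the graph that label the leaves in the subtree `T_x`. -/
def leafSet (x : D.Node) : Set V :=
  {v | (D.leafEquiv v : D.Node) ∈ D.subtree x}

/-- The `f`-width of a branch decomposition: the maximum of `f` over the cuts
`(L(T_x), V \ L(T_x))` given by the nodes `x` of the tree. -/
noncomputable def width (f : Set V → Set V → ℕ) : ℕ :=
  ⨆ x : D.Node, f (D.leafSet x) (D.leafSet x)ᶜ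

end BranchDecomposition

/-- The `f`-branch width of a graph with vertex set `V`: the minimum `f`-width of a branch
decomposition. -/
noncomputable def branchWidth {V : Type*} (f : Set V → Set V → ℕ) : ℕ :=
  sInf {k | ∃ D : BranchDecomposition V, D.width f = k}

/-- The number of edges of a maximum induced matching of `H`. -/
noncomputable def maxInducedMatching {V : Type*} (H : SimpleGraph V) : ℕ :=
  sSup {k | ∃ M : H.Subgraph, M.IsMatching ∧ M.IsInduced ∧ M.edgeSet.ncard = k}

/-- The MIM-width of a finite graph `G`: the branch width for the function that sends a cut
`(X, Y)` to the size of a maximum induced matching of the graph `G[X, Y]`, which has all the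
vertices of `G` and those edges of `G` that have one end in `X` and the other in `Y`. -/
noncomputable def mimWidth {V : Type*} (G : SimpleGraph V) : ℕ :=
  branchWidth fun X Y => maxInducedMatching (G.between X Y)

/-- The vertices of the graph `G'`: two vertices `x v`, `y v` for every vertex `v` of `G`, and
vertices `p e u`, `q e u` for every edge `e` of `G` and every end `u` of `e`. A pair of an edge
`e = uv` and its end `u` is given as the dart `(u, v)`, the edge `e` oriented away from `u`. -/
inductive GadgetVertex {V : Type*} (G : SimpleGraph V) where
  | x (v : V) : GadgetVertex G
  | y (v : V) : GadgetVertex G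
  | p (d : G.Dart) : GadgetVertex G
  | q (d : G.Dart) : GadgetVertex G

/-- The edges of the graph `G'`, each in one orientation. -/
inductive GadgetRel {V : Type*} (G : SimpleGraph V) : GadgetVertex G → GadgetVertex G → Prop
  | xy (v u : V) : GadgetRel G (.x v) (.y u)
  | pq (d : G.Dart) : GadgetRel G (.p d) (.q d)
  | xp (d : G.Dart) : GadgetRel G (.x d.fst) (.p d)
  | yq (d : G.Dart) : GadgetRel G (.y d.snd) (.q d)

/-- The graph `G'`: all edges `x_v y_u`, and for every edge `e` of `G` with ends `u`, `v`, in both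
orders, the path `x_u p_{e,u} q_{e,u} y_v`. -/
def gadget {V : Type*} (G : SimpleGraph V) : SimpleGraph (GadgetVertex G) :=
  SimpleGraph.fromRel (GadgetRel G)

end GraphWidth

/-! Take an optimal branch decomposition of G' and keep, for every vertex v of G, only the leaf of
x_v or of y_v, according to the colour of v. This lays out V(G) injectively on a subcubic tree.
Given a cut of the tree, Kőnig's theorem yields a cover C of the crossing edges of G and |C|
disjoint crossing edges. Bipartiteness lets each of these be read as a path x p q y in G' whose ends
the cut separates, so either x and q or y and q are separated. Each of the two classes of paths
gives an induced matching, hence |C| ≤ 2 mimw(G') (`exists_isSeparation_le`). Adding C to both sides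
of the cut makes it a separation of order |C|. Separations of order at most k at all nodes yield
treewidth at most 3k (`treewidth_le_of_layout`): leftmost minimum separations are nested by
submodularity, and the bags they define are covered by three separators and one vertex. With k = 2
mimw(G') this is the factor 6. -/

namespace GraphWidth

open SimpleGraph

/-! ### Descendants and children in a rooted tree -/

section RootedTree

variable {N : Type*} {T : SimpleGraph N} {r x y z t c c' : N}

/-- The descendants of `x` in the graph `T` rooted in `r`: the nodes that `x` separates from `r`. -/
def below (T : SimpleGraph N) (r x : N) : Set N :=
  {y | ∀ p : T.Walk r y, x ∈ p.support}

/-- The children of `t` in the graph `T` rooted in `r`. -/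
def children (T : SimpleGraph N) (r t : N) : Set N :=
  {c | T.Adj t c ∧ c ∈ below T r t}

theorem mem_below_self (x : N) : x ∈ below T r x := fun p => p.end_mem_support

theorem mem_below_root (x : N) : x ∈ below T r r := fun p => p.start_mem_support

theorem below_trans (hxy : y ∈ below T r x) (hyz : z ∈ below T r y) : z ∈ below T r x := by
  classical
  intro p
  exact p.support_takeUntil_subset_support (hyz p) (hxy _)

theorem below_subset (hxy : y ∈ below T r x) : below T r y ⊆ below T r x :=
  fun _ hz => below_trans hxy hz

theorem mem_below_iff (hT : T.IsTree) {p : T.Walk r y} (hp : p.IsPath) :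
    y ∈ below T r x ↔ x ∈ p.support := by
  classical
  refine ⟨fun h => h p, fun h q => ?_⟩
  have := (hT.existsUnique_path r y).unique hp q.bypass_isPath
  rw [this] at h
  exact q.support_bypass_subset_support h

theorem below_antisymm (hT : T.IsTree) (hxy : y ∈ below T r x) (hyx : x ∈ below T r y) :
    x = y := by
  classical
  obtain ⟨p, hp, -⟩ := hT.existsUnique_path r x
  by_contra hne
  exact Walk.endpoint_notMem_support_takeUntil hp (hyx p) hne
    (hxy (p.takeUntil y (hyx p)))

/-- Both nodes lie on the unique path from the root to `z`, which orders them linearly. -/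
theorem below_total (hT : T.IsTree) (hx : z ∈ below T r x) (hy : z ∈ below T r y) :
    y ∈ below T r x ∨ x ∈ below T r y := by
  classical
  obtain ⟨p, hp, -⟩ := hT.existsUnique_path r z
  have hyp := hy p
  obtain ⟨p₁, p₂, rfl⟩ := Walk.mem_support_iff_exists_append.1 (hx p)
  rcases (Walk.mem_support_append_iff _ _).1 hyp with h | h
  · exact Or.inr ((mem_below_iff hT hp.of_append_left).2 h)
  · obtain ⟨q₁, q₂, rfl⟩ := Walk.mem_support_iff_exists_append.1 h
    rw [Walk.append_assoc] at hp
    exact Or.inl ((mem_below_iff hT hp.of_append_left).2 (by simp))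

theorem mem_below_of_child (hT : T.IsTree) (hc : c ∈ children T r t) (h : c ∈ below T r x) :
    x = c ∨ t ∈ below T r x := by
  obtain ⟨p, hp, -⟩ := hT.existsUnique_path r t
  have hcp : c ∉ p.support := fun h' =>
    hc.1.ne (below_antisymm hT hc.2 ((mem_below_iff hT hp).2 h'))
  rw [mem_below_iff hT (hp.concat hcp hc.1), Walk.support_concat] at h
  rw [mem_below_iff hT hp]
  simpa [or_comm] using h

theorem exists_child (hT : T.IsTree) (h : y ∈ below T r t) (hne : y ≠ t) :
    ∃ c ∈ children T r t, y ∈ below T r c := by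
  classical
  obtain ⟨p, hp, -⟩ := hT.existsUnique_path r y
  obtain ⟨p₁, p₂, rfl⟩ := Walk.mem_support_iff_exists_append.1 (h p)
  cases p₂ with
  | nil => exact absurd rfl hne
  | @cons _ c _ hadj q =>
    have hp' : ((p₁.concat hadj).append q).IsPath := by
      rwa [Walk.concat_append]
    refine ⟨c, ⟨hadj, ?_⟩, ?_⟩
    · rw [mem_below_iff hT hp'.of_append_left]
      simp [Walk.support_concat]
    · rw [mem_below_iff hT hp]
      simp

theorem exists_parent (hT : T.IsTree) (hne : t ≠ r) : ∃ s, t ∈ children T r s := by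
  obtain ⟨p, hp, -⟩ := hT.existsUnique_path r t
  have hnil : ¬ p.Nil := fun h => hne h.eq.symm
  refine ⟨p.penultimate, p.adj_penultimate hnil, ?_⟩
  rw [mem_below_iff hT hp]
  exact p.getVert_mem_support _

theorem disjoint_below_of_children (hT : T.IsTree) (hc : c ∈ children T r t)
    (hc' : c' ∈ children T r t) (hne : c ≠ c') : Disjoint (below T r c) (below T r c') := by
  rw [Set.disjoint_left]
  intro z hz hz'
  wlog h : c' ∈ below T r c generalizing c c'
  · exact this hc' hc hne.symm hz' hz ((below_total hT hz hz').resolve_left h)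
  rcases mem_below_of_child hT hc' h with h | h
  · exact hne h
  · exact hc.1.ne (below_antisymm hT hc.2 h)

/-- Two nodes, neither of them below the other, have disjoint sets of descendants. -/
theorem disjoint_below (hT : T.IsTree) (h : y ∉ below T r x) (h' : x ∉ below T r y) :
    Disjoint (below T r x) (below T r y) := by
  rw [Set.disjoint_left]
  intro z hz hz'
  exact (below_total hT hz hz').elim h h'

theorem below_ssubset_of_child (hT : T.IsTree) (hc : c ∈ children T r t) :
    below T r c ⊂ below T r t :=
  (Set.ssubset_iff_of_subset (below_subset hc.2)).2
    ⟨t, mem_below_self t, fun h => hc.1.ne (below_antisymm hT hc.2 h)⟩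

end RootedTree

/-! ### Minimum separations and uncrossing -/

section Separation

variable {V : Type*} {G : SimpleGraph V} {X Y A B A' B' : Set V}

/-- A separation `(A, B)` of `G` that extends the cut `(X, Xᶜ)`. -/
structure IsSeparation (G : SimpleGraph V) (X A B : Set V) : Prop where
  left : X ⊆ A
  right : Xᶜ ⊆ B
  adj : ∀ ⦃u v⦄, G.Adj u v → (u ∈ A ∧ v ∈ A) ∨ (u ∈ B ∧ v ∈ B)

/-- A separation extending `(X, Xᶜ)` of minimum order. -/
def IsMinSeparation (G : SimpleGraph V) (X A B : Set V) : Prop :=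
  IsSeparation G X A B ∧
    ∀ C D, IsSeparation G X C D → (A ∩ B).ncard ≤ (C ∩ D).ncard

/-- A separation extending `(X, Xᶜ)` of minimum order which is as far left as possible. -/
def IsLeftmostSeparation (G : SimpleGraph V) (X A B : Set V) : Prop :=
  IsMinSeparation G X A B ∧
    ∀ C D, IsMinSeparation G X C D → A.ncard + Bᶜ.ncard ≤ C.ncard + Dᶜ.ncard

theorem IsSeparation.swap (h : IsSeparation G X A B) : IsSeparation G Xᶜ B A :=
  ⟨h.right, by simpa using h.left, fun _ _ huv => (h.adj huv).symm⟩

theorem IsMinSeparation.swap (h : IsMinSeparation G X A B) : IsMinSeparation G Xᶜ B A := by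
  refine ⟨h.1.swap, fun C D hCD => ?_⟩
  have := h.2 D C (by simpa using hCD.swap)
  rwa [Set.inter_comm B A, Set.inter_comm C D]

theorem IsSeparation.inf (h : IsSeparation G X A B) (h' : IsSeparation G Y A' B')
    (hXY : X ⊆ Y) : IsSeparation G X (A ∩ A') (B ∪ B') :=
  ⟨Set.subset_inter h.left (hXY.trans h'.left), h.right.trans Set.subset_union_left,
    fun u v huv => by
      have := h.adj huv
      have := h'.adj huv
      simp only [Set.mem_inter_iff, Set.mem_union]
      tauto⟩

theorem IsSeparation.sup (h : IsSeparation G X A B) (h' : IsSeparation G Y A' B')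
    (hXY : X ⊆ Y) : IsSeparation G Y (A ∪ A') (B ∩ B') :=
  ⟨h'.left.trans Set.subset_union_right,
    Set.subset_inter ((Set.compl_subset_compl.2 hXY).trans h.right) h'.right,
    fun u v huv => by
      have := h.adj huv
      have := h'.adj huv
      simp only [Set.mem_inter_iff, Set.mem_union]
      tauto⟩

theorem exists_isMinSeparation (G : SimpleGraph V) (X : Set V) :
    ∃ A B, IsMinSeparation G X A B := by
  have hne : {P : Set V × Set V | IsSeparation G X P.1 P.2}.Nonempty :=
    ⟨(Set.univ, Set.univ), ⟨by simp, by simp, by simp⟩⟩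
  obtain ⟨P, hP, hmin⟩ := exists_minimalFor_of_wellFoundedLT _
    (fun P : Set V × Set V => (P.1 ∩ P.2).ncard) hne
  exact ⟨P.1, P.2, hP, fun C D h => (le_total _ _).elim id (hmin (j := (C, D)) h)⟩

theorem exists_isLeftmostSeparation (G : SimpleGraph V) (X : Set V) :
    ∃ A B, IsLeftmostSeparation G X A B := by
  obtain ⟨A, B, hAB⟩ := exists_isMinSeparation G X
  have hne : {P : Set V × Set V | IsMinSeparation G X P.1 P.2}.Nonempty := ⟨(A, B), hAB⟩
  obtain ⟨P, hP, hmin⟩ := exists_minimalFor_of_wellFoundedLT _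
    (fun P : Set V × Set V => P.1.ncard + P.2ᶜ.ncard) hne
  exact ⟨P.1, P.2, hP, fun C D h => (le_total _ _).elim id (hmin (j := (C, D)) h)⟩

/-- Submodularity of the order of separations, the source of all uncrossing. -/
theorem ncard_inter_union_add_le [Finite V] (A B A' B' : Set V) :
    ((A ∩ A') ∩ (B ∪ B')).ncard + ((A ∪ A') ∩ (B ∩ B')).ncard ≤
      (A ∩ B).ncard + (A' ∩ B').ncard := by
  rw [← Set.ncard_union_add_ncard_inter, ← Set.ncard_union_add_ncard_inter (A ∩ B)]
  refine add_le_add (Set.ncard_le_ncard ?_) (Set.ncard_le_ncard ?_) <;>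
  · intro v
    simp only [Set.mem_inter_iff, Set.mem_union]
    tauto

/-- Leftmost separations lie to the left of all minimum separations of larger sets. -/
theorem IsLeftmostSeparation.subset [Finite V] (h : IsLeftmostSeparation G X A B)
    (h' : IsMinSeparation G Y A' B') (hXY : X ⊆ Y) : A ⊆ A' ∧ B' ⊆ B := by
  have hinf := h.1.1.inf h'.1 hXY
  -- The other corner extends the cut of `Y`, so its order is at least that of `(A', B')`; by
  -- submodularity this corner has order at most that of `(A, B)`.
  have hmin : IsMinSeparation G X (A ∩ A') (B ∪ B') := by
    refine ⟨hinf, fun C D hCD => ?_⟩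
    have h1 := ncard_inter_union_add_le A B A' B'
    have h2 := h'.2 _ _ (h.1.1.sup h'.1 hXY)
    have h3 := h.1.2 _ _ hCD
    omega
  -- Both terms of the tie-breaker can only shrink in passing to the corner, so leftmost choice
  -- forces equality in each.
  have hle := h.2 _ _ hmin
  have h1 : (A ∩ A').ncard ≤ A.ncard := Set.ncard_le_ncard Set.inter_subset_left
  have h2 : (B ∪ B')ᶜ.ncard ≤ Bᶜ.ncard :=
    Set.ncard_le_ncard (Set.compl_subset_compl.2 Set.subset_union_left)
  have h3 : A ∩ A' = A := Set.eq_of_subset_of_ncard_le Set.inter_subset_left (by omega)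
  have h4 : (B ∪ B')ᶜ = Bᶜ :=
    Set.eq_of_subset_of_ncard_le (Set.compl_subset_compl.2 Set.subset_union_left) (by omega)
  exact ⟨Set.inter_eq_left.1 h3, Set.union_eq_left.1 (compl_injective h4)⟩

end Separation

/-! ### From a layout with small separations to a tree decomposition -/

section Layout

variable {V : Type*} {G : SimpleGraph V} {N : Type} {T : SimpleGraph N} {r : N} {l : V → N}
  {A B : N → Set V}

/-- The bag of the node `t`, given a pair of sets `(A x, B x)` for every node `x`. -/
def layoutBag (T : SimpleGraph N) (r : N) (A B : N → Set V) (t : N) : Set V :=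
  {v | v ∈ A t ∧ ∀ c ∈ children T r t, v ∈ B c}

/-- A family of pairs `(A x, B x)`, indexed by the nodes of a tree, that behaves like the cuts
`(l ⁻¹' below T r x, (l ⁻¹' below T r x)ᶜ)` of a layout `l`. -/
structure IsNested (T : SimpleGraph N) (r : N) (A B : N → Set V) : Prop where
  left_mono : ∀ ⦃x y⦄, y ∈ below T r x → A y ⊆ A x
  right_anti : ∀ ⦃x y⦄, y ∈ below T r x → B x ⊆ B y
  left_subset_right : ∀ ⦃x y⦄, Disjoint (below T r x) (below T r y) → A x ⊆ B y

theorem isNested_of_isLeftmostSeparation [Finite V]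
    (h : ∀ x, IsLeftmostSeparation G (l ⁻¹' below T r x) (A x) (B x)) : IsNested T r A B where
  left_mono x y hxy := ((h y).subset (h x).1 (Set.preimage_mono (below_subset hxy))).1
  right_anti x y hxy := ((h y).subset (h x).1 (Set.preimage_mono (below_subset hxy))).2
  -- Swapping the sides at `y` gives a minimum separation for the complement of its cut set, which
  -- contains the cut set of `x`.
  left_subset_right x y hxy := ((h x).subset (h y).1.swap
    ((hxy.preimage l).subset_compl_right)).1

/-- Both ends of an edge lie in the bag of a deepest node with both ends on its left side. -/
theorem exists_layoutBag [Finite N] (hT : T.IsTree) (hroot : A r = Set.univ) {u v : V}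
    (h : ∀ x, (u ∈ A x ∧ v ∈ A x) ∨ (u ∈ B x ∧ v ∈ B x)) :
    ∃ t, u ∈ layoutBag T r A B t ∧ v ∈ layoutBag T r A B t := by
  have hne : {t | u ∈ A t ∧ v ∈ A t}.Nonempty := ⟨r, by simp [hroot]⟩
  obtain ⟨t, ht, hmin⟩ := exists_minimalFor_of_wellFoundedLT _
    (fun t => (below T r t).ncard) hne
  have hc : ∀ c ∈ children T r t, u ∈ B c ∧ v ∈ B c := fun c hc =>
    (h c).resolve_left fun hA =>
      (Set.ncard_lt_ncard (below_ssubset_of_child hT hc)).not_ge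
        (hmin hA (Set.ncard_le_ncard (below_subset hc.2)))
  exact ⟨t, ⟨ht.1, fun c h => (hc c h).1⟩, ⟨ht.2, fun c h => (hc c h).2⟩⟩

theorem IsNested.mem_layoutBag_parent (hT : T.IsTree) (hAB : IsNested T r A B) {v : V}
    {s t : N} (hs : t ∈ children T r s) (ht : v ∈ layoutBag T r A B t) (hv : v ∈ B t) :
    v ∈ layoutBag T r A B s := by
  refine ⟨hAB.left_mono hs.2 ht.1, fun c hc => ?_⟩
  rcases eq_or_ne t c with rfl | hne
  · exact hv
  · exact hAB.left_subset_right (disjoint_below_of_children hT hs hc hne) ht.1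

/-- The top of the subtree of nodes whose bags contain a given vertex is unique. -/
theorem IsNested.top_unique (hT : T.IsTree) (hAB : IsNested T r A B) {v : V} {s t : N}
    (hs : v ∈ layoutBag T r A B s) (ht : v ∈ layoutBag T r A B t)
    (hs' : s = r ∨ v ∉ B s) (ht' : t = r ∨ v ∉ B t) : s = t := by
  have key : ∀ {s t : N}, v ∈ layoutBag T r A B s → (t = r ∨ v ∉ B t) → t ∈ below T r s →
      s = t := by
    intro s t hs ht hst
    by_contra hne
    obtain ⟨c, hc, htc⟩ := exists_child hT hst (Ne.symm hne)
    rcases ht with rfl | ht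
    · exact hne (below_antisymm hT hst (mem_below_root s))
    · exact ht (hAB.right_anti htc (hs.2 c hc))
  by_cases h : t ∈ below T r s
  · exact key hs ht' h
  by_cases h' : s ∈ below T r t
  · exact (key ht hs' h').symm
  rcases ht' with rfl | ht'
  · exact absurd (mem_below_root s) h'
  · exact absurd (hAB.left_subset_right (disjoint_below hT h h') hs.1) ht'

/-- From any bag containing `v` one can climb through such bags until the root or a node with `v ∉ B
t`; this end is unique by `top_unique`, so all climbs meet. -/
theorem IsNested.preconnected (hT : T.IsTree) [Finite N] (hAB : IsNested T r A B) (v : V) :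
    (T.induce {t | v ∈ layoutBag T r A B t}).Preconnected := by
  have climb : ∀ n, ∀ t : {t | v ∈ layoutBag T r A B t}, (below T r t.1)ᶜ.ncard = n →
      ∃ s : {t | v ∈ layoutBag T r A B t}, (s.1 = r ∨ v ∉ B s.1) ∧
        (T.induce {t | v ∈ layoutBag T r A B t}).Reachable t s := by
    intro n
    induction n using Nat.strong_induction_on with
    | _ n ih =>
      rintro ⟨t, ht⟩ hn
      by_cases htop : t = r ∨ v ∉ B t
      · exact ⟨⟨t, ht⟩, htop, Reachable.refl _⟩
      push Not at htop
      obtain ⟨p, hp⟩ := exists_parent hT htop.1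
      have hpv := hAB.mem_layoutBag_parent hT hp ht htop.2
      have hlt : (below T r p)ᶜ.ncard < n := by
        rw [← hn]
        exact Set.ncard_lt_ncard (compl_lt_compl_iff_lt.2 (below_ssubset_of_child hT hp))
      obtain ⟨s, hs, hps⟩ := ih _ hlt ⟨p, hpv⟩ rfl
      refine ⟨s, hs, Reachable.trans (Adj.reachable ?_) hps⟩
      exact hp.1.symm
  intro s t
  obtain ⟨s', hs', hss'⟩ := climb _ s rfl
  obtain ⟨t', ht', htt'⟩ := climb _ t rfl
  have : s' = t' := Subtype.ext (hAB.top_unique hT s'.2 t'.2 hs' ht')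
  subst this
  exact hss'.trans htt'.symm

/-- A bag is covered by the vertex at its node and by the intersections `A x ∩ B x` for at most
three nodes `x`. -/
theorem ncard_layoutBag_le [Finite V] [Finite N] (hT : T.IsTree)
    (hdeg : ∀ t, (T.neighborSet t).ncard ≤ 3) (hl : Function.Injective l)
    (hA : ∀ x, l ⁻¹' below T r x ⊆ A x) (hB : ∀ x, (l ⁻¹' below T r x)ᶜ ⊆ B x)
    {k : ℕ} (hk : ∀ x, (A x ∩ B x).ncard ≤ k) (t : N) :
    (layoutBag T r A B t).ncard ≤ 3 * k + 1 := by
  classical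
  obtain ⟨S, hS, hcov⟩ : ∃ S : Set N, S.ncard ≤ 3 ∧
      layoutBag T r A B t ⊆ l ⁻¹' {t} ∪ ⋃ x ∈ S, A x ∩ B x := by
    have hmem : ∀ v ∈ layoutBag T r A B t, l v ∈ below T r t →
        v ∈ l ⁻¹' {t} ∪ ⋃ x ∈ children T r t, A x ∩ B x := by
      intro v hv hlv
      by_cases hvt : l v = t
      · exact Or.inl hvt
      · obtain ⟨c, hc, hvc⟩ := exists_child hT hlv hvt
        exact Or.inr (Set.mem_biUnion hc ⟨hA c hvc, hv.2 c hc⟩)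
    have hsub : children T r t ⊆ T.neighborSet t := fun c hc => hc.1
    by_cases htr : t = r
    · refine ⟨children T r t, (Set.ncard_le_ncard hsub).trans (hdeg t), fun v hv => ?_⟩
      exact hmem v hv (htr ▸ mem_below_root _)
    · obtain ⟨p, hp⟩ := exists_parent hT htr
      have hpt : p ∉ children T r t := fun h => hp.1.ne (below_antisymm hT hp.2 h.2)
      have hle : (insert p (children T r t)).ncard ≤ 3 :=
        (Set.ncard_le_ncard (Set.insert_subset hp.1.symm hsub)).trans (hdeg t)
      rw [Set.ncard_insert_of_notMem hpt] at hle
      -- The parent uses up one of the three neighbours, which leaves room for the separator of `t`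
      -- itself; it catches the vertices laid out outside the subtree of `t`.
      refine ⟨insert t (children T r t), (Set.ncard_insert_le _ _).trans hle, fun v hv => ?_⟩
      rw [Set.biUnion_insert]
      by_cases hlv : l v ∈ below T r t
      · exact (hmem v hv hlv).elim Or.inl (fun h => Or.inr (Or.inr h))
      · exact Or.inr (Or.inl ⟨hv.1, hB t hlv⟩)
  have hone : (l ⁻¹' {t}).ncard ≤ 1 :=
    (Set.ncard_le_one (Set.toFinite _)).2 fun _ ha _ hb => hl (ha.trans hb.symm)
  have hunion : (⋃ x ∈ S, A x ∩ B x).ncard ≤ S.ncard * k := by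
    have := Fintype.ofFinite N
    have := Fintype.ofFinite V
    rw [Set.ncard_eq_toFinset_card' S, Set.ncard_eq_toFinset_card']
    refine le_trans (Finset.card_le_card ?_)
      (Finset.card_biUnion_le_card_mul S.toFinset (fun x => (A x ∩ B x).toFinset) k ?_)
    · intro v hv
      simpa [and_left_comm] using hv
    · intro x _
      rw [← Set.ncard_eq_toFinset_card']
      exact hk x
  calc (layoutBag T r A B t).ncard ≤ (l ⁻¹' {t} ∪ ⋃ x ∈ S, A x ∩ B x).ncard :=
        Set.ncard_le_ncard hcov
    _ ≤ (l ⁻¹' {t}).ncard + (⋃ x ∈ S, A x ∩ B x).ncard := Set.ncard_union_le _ _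
    _ ≤ 1 + S.ncard * k := add_le_add hone hunion
    _ ≤ 1 + 3 * k := by gcongr
    _ = 3 * k + 1 := add_comm _ _

/-- If all cuts of an injective layout of the vertices of `G` on a subcubic tree extend to
separations of order at most `k`, then the treewidth of `G` is at most `3 * k`. -/
theorem treewidth_le_of_layout [Finite V] (G : SimpleGraph V) [Finite N] (hT : T.IsTree)
    (hdeg : ∀ t, (T.neighborSet t).ncard ≤ 3) (r : N) (hl : Function.Injective l) {k : ℕ}
    (h : ∀ x, ∃ A B, IsSeparation G (l ⁻¹' below T r x) A B ∧ (A ∩ B).ncard ≤ k) :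
    treewidth G ≤ 3 * k := by
  choose A B hAB using fun x => exists_isLeftmostSeparation G (l ⁻¹' below T r x)
  have hnest := isNested_of_isLeftmostSeparation hAB
  have hroot : A r = Set.univ := Set.eq_univ_of_forall fun v =>
    (hAB r).1.1.left (mem_below_root (l v))
  refine Nat.sInf_le ⟨⟨N, ‹_›, T, hT, layoutBag T r A B, fun v => ?_, fun u v huv => ?_,
    fun v => hnest.preconnected hT v⟩, fun t => ?_⟩
  · obtain ⟨t, ht, -⟩ := exists_layoutBag (B := B) hT hroot (u := v) (v := v) fun x => by
      by_cases hv : l v ∈ below T r x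
      · exact Or.inl ⟨(hAB x).1.1.left hv, (hAB x).1.1.left hv⟩
      · exact Or.inr ⟨(hAB x).1.1.right hv, (hAB x).1.1.right hv⟩
    exact ⟨t, ht⟩
  · exact exists_layoutBag hT hroot fun x => (hAB x).1.1.adj huv
  · refine ncard_layoutBag_le hT hdeg hl (fun x => (hAB x).1.1.left)
      (fun x => (hAB x).1.1.right) (fun x => ?_) t
    obtain ⟨C, D, hCD, hle⟩ := h x
    exact ((hAB x).1.2 C D hCD).trans hle

end Layout

/-! ### Kőnig's theorem via Hall's condition -/

section Konig

variable {V : Type*}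

/-- Hall's condition for the independent subsets of a minimum vertex cover `C`. -/
theorem card_le_card_neighbors_of_min_cover [Fintype V] [DecidableEq V] {H : SimpleGraph V}
    [DecidableRel H.Adj] {C : Finset V} (hC : ∀ u v, H.Adj u v → u ∈ C ∨ v ∈ C)
    (hmin : ∀ D : Finset V, (∀ u v, H.Adj u v → u ∈ D ∨ v ∈ D) → C.card ≤ D.card)
    {S : Finset V} (hSC : S ⊆ C) (hS : ∀ u ∈ S, ∀ v ∈ S, ¬ H.Adj u v) :
    S.card ≤ (Finset.univ.filter fun w => ∃ c ∈ S, w ∉ C ∧ H.Adj c w).card := by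
  set M := Finset.univ.filter fun w => ∃ c ∈ S, w ∉ C ∧ H.Adj c w with hM
  -- Exchanging `S` for `M` keeps a cover: as `S` is independent, an edge at `S` ends in `C \ S` or
  -- in `M`.
  have hcov : ∀ u v, H.Adj u v → u ∈ C → u ∈ C \ S ∪ M ∨ v ∈ C \ S ∪ M := by
    intro u v huv hu
    by_cases huS : u ∈ S
    · right
      have hvS : v ∉ S := fun hv => hS u huS v hv huv
      by_cases hv : v ∈ C
      · simp [hv, hvS]
      · refine Finset.mem_union_right _ ?_
        simp only [hM, Finset.mem_filter, Finset.mem_univ, true_and]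
        exact ⟨u, huS, hv, huv⟩
    · left
      simp [hu, huS]
  have h1 := hmin (C \ S ∪ M) fun u v huv =>
    (hC u v huv).elim (hcov u v huv) fun hv => (hcov v u huv.symm hv).symm
  have h2 := Finset.card_union_le (C \ S) M
  have h3 := Finset.card_sdiff_add_card_eq_card hSC
  omega

/-- **Kőnig's theorem**: a bipartite graph has a vertex cover whose vertices can be matched into
its complement. -/
theorem exists_cover_matched [Finite V] {H : SimpleGraph V} {X : Set V}
    (hX : ∀ u v, H.Adj u v → (u ∈ X ↔ v ∉ X)) :
    ∃ C : Set V, (∀ u v, H.Adj u v → u ∈ C ∨ v ∈ C) ∧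
      ∃ f : C → V, Function.Injective f ∧ ∀ c, f c ∉ C ∧ H.Adj c (f c) := by
  classical
  have := Fintype.ofFinite V
  obtain ⟨C, hC, hmin⟩ := exists_minimalFor_of_wellFoundedLT
    (fun C : Finset V => ∀ u v, H.Adj u v → u ∈ C ∨ v ∈ C) Finset.card
    ⟨Finset.univ, by simp⟩
  replace hmin : ∀ D : Finset V, (∀ u v, H.Adj u v → u ∈ D ∨ v ∈ D) → C.card ≤ D.card :=
    fun D hD => (le_total _ _).elim id (hmin hD)
  refine ⟨C, by simpa using hC, ?_⟩
  have hall := (Fintype.all_card_le_filter_rel_iff_exists_injective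
    (fun (c : (C : Set V)) (w : V) => w ∉ (C : Set V) ∧ H.Adj c w)).1 ?_
  · exact hall
  intro S
  set S' : Finset V := S.map (Function.Embedding.subtype _) with hS'
  have hS'C : S' ⊆ C := by
    intro v hv
    simp only [hS', Finset.mem_map, Function.Embedding.subtype_apply] at hv
    obtain ⟨w, -, rfl⟩ := hv
    exact w.2
  -- Each half of `S'`, inside `X` and outside, is independent, and the neighbours of the two halves
  -- lie on opposite sides, so the two bounds add up.
  have key := fun (S : Finset V) => card_le_card_neighbors_of_min_cover (S := S) hC hmin
  have h1 := key (S'.filter (· ∈ X)) ((Finset.filter_subset _ _).trans hS'C) (by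
    intro u hu v hv huv
    exact (hX u v huv).1 (Finset.mem_filter.1 hu).2 (Finset.mem_filter.1 hv).2)
  have h2 := key (S'.filter (· ∉ X)) ((Finset.filter_subset _ _).trans hS'C) (by
    intro u hu v hv huv
    exact (Finset.mem_filter.1 hu).2 ((hX u v huv).2 (Finset.mem_filter.1 hv).2))
  have h3 := Finset.card_filter_add_card_filter_not (s := S') (· ∈ X)
  rw [← Finset.card_map (Function.Embedding.subtype _), ← hS', ← h3]
  refine (add_le_add h1 h2).trans ?_
  rw [← Finset.card_union_of_disjoint]
  · refine Finset.card_le_card fun w => ?_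
    simp only [hS', Finset.mem_union, Finset.mem_filter, Finset.mem_univ, true_and,
      Finset.mem_map, Function.Embedding.subtype_apply]
    rintro (⟨_, ⟨⟨c, hc, rfl⟩, -⟩, hw, hcw⟩ | ⟨_, ⟨⟨c, hc, rfl⟩, -⟩, hw, hcw⟩) <;>
      exact ⟨c, hc, hw, hcw⟩
  · rw [Finset.disjoint_left]
    intro w hw hw'
    obtain ⟨c, hc, -, hcw⟩ := (Finset.mem_filter.1 hw).2
    obtain ⟨c', hc', -, hcw'⟩ := (Finset.mem_filter.1 hw').2
    have hwX := (hX _ _ hcw).1 (Finset.mem_filter.1 hc).2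
    have hwX' := mt (hX _ _ hcw').2 (Finset.mem_filter.1 hc').2
    exact hwX' hwX

end Konig

/-! ### Lower bounds for induced matchings -/

section InducedMatching

variable {W : Type*}

theorem ncard_edgeSet_le_maxInducedMatching [Finite W] {H : SimpleGraph W} {M : H.Subgraph}
    (hM : M.IsMatching) (hM' : M.IsInduced) : M.edgeSet.ncard ≤ maxInducedMatching H := by
  refine le_csSup ⟨Nat.card (Sym2 W), ?_⟩ ⟨M, hM, hM', rfl⟩
  rintro _ ⟨M, -, -, rfl⟩
  exact Set.ncard_le_card _

/-- A family of edges `a i, b i` without edges between its distinct members is an induced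
matching. -/
theorem card_le_maxInducedMatching [Finite W] {ι : Type*} [Finite ι] {H : SimpleGraph W}
    {a b : ι → W} (hab : ∀ i, H.Adj (a i) (b i))
    (hind : ∀ i j u v, (u = a i ∨ u = b i) → (v = a j ∨ v = b j) → H.Adj u v → i = j) :
    Nat.card ι ≤ maxInducedMatching H := by
  let M : H.Subgraph := (⊤ : H.Subgraph).induce {w | ∃ i, w = a i ∨ w = b i}
  have hadj : ∀ {u v}, M.Adj u v ↔
      (∃ i, u = a i ∨ u = b i) ∧ (∃ j, v = a j ∨ v = b j) ∧ H.Adj u v := Iff.rfl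
  have hM : M.IsMatching := by
    rintro _ ⟨i, rfl | rfl⟩
    · refine ⟨b i, ⟨⟨i, Or.inl rfl⟩, ⟨i, Or.inr rfl⟩, hab i⟩, ?_⟩
      rintro w ⟨-, ⟨j, hj⟩, h⟩
      obtain rfl := hind i j _ _ (Or.inl rfl) hj h
      exact hj.resolve_left (Ne.symm h.ne)
    · refine ⟨a i, ⟨⟨i, Or.inr rfl⟩, ⟨i, Or.inl rfl⟩, (hab i).symm⟩, ?_⟩
      rintro w ⟨-, ⟨j, hj⟩, h⟩
      obtain rfl := hind i j _ _ (Or.inr rfl) hj h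
      exact hj.resolve_right (Ne.symm h.ne)
  have hM' : M.IsInduced := fun u hu v hv huv => ⟨hu, hv, huv⟩
  refine le_trans ?_ (ncard_edgeSet_le_maxInducedMatching hM hM')
  have hmem : ∀ i, s(a i, b i) ∈ M.edgeSet := fun i =>
    ⟨⟨i, Or.inl rfl⟩, ⟨i, Or.inr rfl⟩, hab i⟩
  refine Nat.card_le_card_of_injective (fun i => (⟨_, hmem i⟩ : M.edgeSet)) fun i j hij => ?_
  have hij : s(a i, b i) = s(a j, b j) := congrArg Subtype.val hij
  have hmem' : a i = a j ∨ a i = b j := by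
    rw [← Sym2.mem_iff, ← hij]
    exact Sym2.mem_mk_left _ _
  exact hind i j _ _ (Or.inr rfl) hmem' (hab i).symm

end InducedMatching

/-! ### From crossing edges of G to induced matchings of G' -/

section Gadget

variable {V : Type*} {G : SimpleGraph V}

instance [Finite V] : Finite (GadgetVertex G) := by
  have : Finite G.Dart := Finite.of_injective _ Dart.toProd_injective
  let g : GadgetVertex G → (V ⊕ V) ⊕ (G.Dart ⊕ G.Dart) := fun
    | .x v => .inl (.inl v)
    | .y v => .inl (.inr v)
    | .p d => .inr (.inl d)
    | .q d => .inr (.inr d)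
  refine Finite.of_injective g ?_
  rintro (v | v | d | d) (w | w | e | e) h <;> simp_all [g]

theorem gadgetRel_iff {a b : GadgetVertex G} : GadgetRel G a b ↔
    (∃ v u, a = .x v ∧ b = .y u) ∨ (∃ d, a = .p d ∧ b = .q d) ∨
      (∃ d : G.Dart, a = .x d.fst ∧ b = .p d) ∨ (∃ d : G.Dart, a = .y d.snd ∧ b = .q d) := by
  constructor
  · rintro (⟨v, u⟩ | d | d | d) <;> simp
  · rintro (⟨v, u, rfl, rfl⟩ | ⟨d, rfl, rfl⟩ | ⟨d, rfl, rfl⟩ | ⟨d, rfl, rfl⟩)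
    · exact .xy v u
    · exact .pq d
    · exact .xp d
    · exact .yq d

theorem gadget_adj {a b : GadgetVertex G} :
    (gadget G).Adj a b ↔ a ≠ b ∧ (GadgetRel G a b ∨ GadgetRel G b a) :=
  fromRel_adj _ _ _

/-- The edges `p q` and `x p` crossing a cut form an induced matching if they belong to
different vertices `x`. -/
theorem card_le_maxInducedMatching_of_fst [Finite V] {ι : Type*} [Finite ι]
    {X : Set (GadgetVertex G)} {d : ι → G.Dart} (hd : Function.Injective fun i => (d i).fst)
    (hX : ∀ i, ¬ (.x (d i).fst ∈ X ↔ .q (d i) ∈ X)) :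
    Nat.card ι ≤ maxInducedMatching ((gadget G).between X Xᶜ) := by
  classical
  -- As x and q are separated, exactly one of the edges x p and p q crosses; the side of p decides
  -- which. No y occurs, so the complete bipartite part of G' adds no edge.
  refine card_le_maxInducedMatching (a := fun i => .p (d i))
    (b := fun i => if (.x (d i).fst ∈ X ↔ .p (d i) ∈ X) then .q (d i) else .x (d i).fst)
    (fun i => ?_) ?_
  · have := hX i
    rw [between_adj, gadget_adj]
    split_ifs with h
    · refine ⟨by simp [gadgetRel_iff], ?_⟩
      simp only [Set.mem_compl_iff]
      tauto
    · refine ⟨by simp [gadgetRel_iff], ?_⟩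
      simp only [Set.mem_compl_iff]
      tauto
  · intro i j u v hu hv huv
    replace hu : u = .p (d i) ∨ u = .q (d i) ∨ u = .x (d i).fst := by
      split_ifs at hu <;> tauto
    replace hv : v = .p (d j) ∨ v = .q (d j) ∨ v = .x (d j).fst := by
      split_ifs at hv <;> tauto
    replace huv := (gadget_adj.1 huv.1).2
    refine hd ?_
    dsimp only
    rcases hu with rfl | rfl | rfl <;> rcases hv with rfl | rfl | rfl <;>
      simp_all [gadgetRel_iff]

/-- The edges `y q` crossing a cut form an induced matching if they belong to different
vertices `y`. -/
theorem card_le_maxInducedMatching_of_snd [Finite V] {ι : Type*} [Finite ι]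
    {X : Set (GadgetVertex G)} {d : ι → G.Dart} (hd : Function.Injective fun i => (d i).snd)
    (hX : ∀ i, ¬ (.y (d i).snd ∈ X ↔ .q (d i) ∈ X)) :
    Nat.card ι ≤ maxInducedMatching ((gadget G).between X Xᶜ) := by
  refine card_le_maxInducedMatching (a := fun i => .y (d i).snd) (b := fun i => .q (d i))
    (fun i => ?_) ?_
  · have := hX i
    rw [between_adj, gadget_adj]
    refine ⟨by simp [gadgetRel_iff], ?_⟩
    simp only [Set.mem_compl_iff]
    tauto
  · intro i j u v hu hv huv
    replace huv := (gadget_adj.1 huv.1).2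
    refine hd ?_
    dsimp only
    rcases hu with rfl | rfl <;> rcases hv with rfl | rfl <;> simp_all [gadgetRel_iff]

/-- The vertex of `G'` that stands for the vertex `v` of the bipartite graph `G`. -/
def representative (G : SimpleGraph V) (col : G.Coloring (Fin 2)) (v : V) : GadgetVertex G :=
  if col v = 0 then .x v else .y v

theorem representative_injective (col : G.Coloring (Fin 2)) :
    Function.Injective (representative G col) := by
  intro u v h
  unfold representative at h
  split_ifs at h <;> simpa using h

/-- Every edge can be oriented such that its ends are represented by an `x` and a `y`. -/
theorem exists_dart (col : G.Coloring (Fin 2)) {u v : V} (h : G.Adj u v) :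
    ∃ d : G.Dart, (d.fst = u ∧ d.snd = v ∨ d.fst = v ∧ d.snd = u) ∧
      representative G col d.fst = .x d.fst ∧ representative G col d.snd = .y d.snd := by
  have hne := col.valid h
  by_cases hu : col u = 0
  · refine ⟨⟨(u, v), h⟩, Or.inl ⟨rfl, rfl⟩, by simp [representative, hu], ?_⟩
    have hv : col v ≠ 0 := fun hv => hne (hu.trans hv.symm)
    simp [representative, hv]
  · have hv : col v = 0 := by omega
    exact ⟨⟨(v, u), h.symm⟩, Or.inr ⟨rfl, rfl⟩, by simp [representative, hv],
      by simp [representative, hu]⟩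

/-- The cut of `G` induced by a cut of `G'` extends to a separation whose order is at most twice
the size of a maximum induced matching of the cut of `G'`. -/
theorem exists_isSeparation_le [Finite V] (col : G.Coloring (Fin 2))
    (X : Set (GadgetVertex G)) :
    ∃ A B, IsSeparation G (representative G col ⁻¹' X) A B ∧
      (A ∩ B).ncard ≤ 2 * maxInducedMatching ((gadget G).between X Xᶜ) := by
  set Y := representative G col ⁻¹' X with hY
  obtain ⟨C, hC, f, hf, hfC⟩ := exists_cover_matched (H := G.between Y Yᶜ) (X := Y) (by
    rintro u v ⟨-, h | h⟩ <;> simp_all)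
  -- Every crossing edge has an end in `C`, hence lies within one of the two sides.
  refine ⟨Y ∪ C, Yᶜ ∪ C, ⟨Set.subset_union_left, Set.subset_union_left, fun u v huv => ?_⟩, ?_⟩
  · have := hC u v
    rw [between_adj] at this
    simp only [Set.mem_union, Set.mem_compl_iff] at this ⊢
    tauto
  have hYC : (Y ∪ C) ∩ (Yᶜ ∪ C) = C := by
    rw [← Set.inter_union_distrib_right, Set.inter_compl_self, Set.empty_union]
  rw [hYC]
  choose d hd hx hy using fun c : C => exists_dart col (hfC c).2.1
  have hcut : ∀ c, ¬ (GadgetVertex.x (d c).fst ∈ X ↔ GadgetVertex.y (d c).snd ∈ X) := by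
    intro c
    have hcross : ((d c).fst ∈ Y ∧ (d c).snd ∈ Yᶜ) ∨ ((d c).fst ∈ Yᶜ ∧ (d c).snd ∈ Y) := by
      rcases hd c with ⟨h1, h2⟩ | ⟨h1, h2⟩ <;> rw [h1, h2]
      · exact (hfC c).2.2
      · exact (hfC c).2.2.symm.imp And.symm And.symm
    rw [← hx, ← hy]
    simp only [hY, Set.mem_compl_iff, Set.mem_preimage] at hcross
    tauto
  -- The edges from `c` to `f c` are pairwise disjoint, because `f` is injective and avoids `C`.
  have hends : ∀ c c' : C, ∀ v : V, (v = c ∨ v = f c) → (v = c' ∨ v = f c') → c = c' := by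
    rintro c c' v (h | h) (h' | h')
    · exact Subtype.ext (h.symm.trans h')
    · exact absurd (h'.symm.trans h ▸ c.2) (hfC c').1
    · exact absurd (h.symm.trans h' ▸ c'.2) (hfC c).1
    · exact hf (h.symm.trans h')
  have hfst : Function.Injective fun c => (d c).fst := fun c c' (h : (d c).fst = _) =>
    hends c c' (d c).fst ((hd c).imp And.left And.left)
      (by rw [h]; exact (hd c').imp And.left And.left)
  have hsnd : Function.Injective fun c => (d c).snd := fun c c' (h : (d c).snd = _) =>
    hends c c' (d c).snd ((hd c).symm.imp And.right And.right)
      (by rw [h]; exact (hd c').symm.imp And.right And.right)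
  -- Outside `S` the vertex q is on the side of x, so it is separated from y.
  let S : Set C := {c | ¬ (GadgetVertex.x (d c).fst ∈ X ↔ GadgetVertex.q (d c) ∈ X)}
  have h1 : Nat.card S ≤ _ := card_le_maxInducedMatching_of_fst (X := X)
    (d := fun c : S => d c) (hfst.comp Subtype.val_injective) fun c => c.2
  have h2 : Nat.card (Sᶜ : Set C) ≤ _ := card_le_maxInducedMatching_of_snd (X := X)
    (d := fun c : (Sᶜ : Set C) => d c) (hsnd.comp Subtype.val_injective) fun c => by
      have := hcut c
      have := not_not.1 c.2
      tauto
  have h3 := Set.ncard_add_ncard_compl S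
  rw [Nat.card_coe_set_eq] at h1 h2 h3
  omega

end Gadget

/-! ### Existence of branch decompositions -/

section Heap

/-- The complete binary tree with `m` nodes: the parent of `i + 1` is `i / 2`. -/
def heap (m : ℕ) : SimpleGraph (Fin m) :=
  fromRel fun i j => j.val = 2 * i.val + 1 ∨ j.val = 2 * i.val + 2

theorem heap_adj {m : ℕ} {i j : Fin m} : (heap m).Adj i j ↔
    (j.val = 2 * i.val + 1 ∨ j.val = 2 * i.val + 2) ∨
      (i.val = 2 * j.val + 1 ∨ i.val = 2 * j.val + 2) := by
  rw [heap, fromRel_adj]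
  refine ⟨fun h => h.2, fun h => ⟨?_, h⟩⟩
  rintro rfl
  omega

theorem heap_connected (m : ℕ) : (heap (m + 1)).Connected := by
  have h : ∀ n, ∀ i : Fin (m + 1), i.val = n → (heap (m + 1)).Reachable i 0 := by
    intro n
    induction n using Nat.strong_induction_on with
    | _ n ih =>
      intro i hi
      rcases Nat.eq_zero_or_pos n with rfl | hn
      · rw [Fin.ext (a := i) (b := 0) hi]
      · let j : Fin (m + 1) := ⟨(i.val - 1) / 2, by omega⟩
        have hij : (heap (m + 1)).Adj i j := heap_adj.2 (by simp only [j]; omega)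
        exact hij.reachable.trans (ih j.val (by simp only [j]; omega) j rfl)
  exact ⟨fun i j => (h _ i rfl).trans (h _ j rfl).symm⟩

/-- Each edge joins a nonroot node to its parent, so there are at most `m` edges, the least number
that connectedness allows. -/
theorem heap_isTree (m : ℕ) : (heap (m + 1)).IsTree := by
  rw [isTree_iff_connected_and_card]
  refine ⟨heap_connected m, le_antisymm ?_ (heap_connected m).card_vert_le_card_edgeSet_add_one⟩
  let g : Fin m → Sym2 (Fin (m + 1)) := fun i => s(i.succ, ⟨i.val / 2, by omega⟩)
  have hsub : (heap (m + 1)).edgeSet ⊆ Set.range g := by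
    have key : ∀ i j : Fin (m + 1), (j.val = 2 * i.val + 1 ∨ j.val = 2 * i.val + 2) →
        s(j, i) ∈ Set.range g := by
      intro i j h
      refine ⟨⟨j.val - 1, by omega⟩, ?_⟩
      have h1 : (⟨j.val - 1, by omega⟩ : Fin m).succ = j := Fin.ext (by simp; omega)
      have h2 : (⟨(j.val - 1) / 2, by omega⟩ : Fin (m + 1)) = i := Fin.ext (by simp; omega)
      simp only [g, h1, h2]
    intro e
    induction e with
    | _ i j =>
      intro h
      rcases heap_adj.1 h with h | h
      · rw [Sym2.eq_swap]
        exact key i j h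
      · exact key j i h
  have h1 := Set.ncard_le_ncard hsub
  have h2 : (Set.range g).ncard ≤ m := by
    rw [← Set.image_univ]
    refine (Set.ncard_image_le).trans ?_
    simp
  rw [Nat.card_coe_set_eq, Nat.card_fin]
  omega

theorem heap_neighborSet_ncard_le {m : ℕ} (t : Fin m) :
    ((heap m).neighborSet t).ncard ≤ 3 := by
  have hinj : ((heap m).neighborSet t).ncard =
      (Fin.val '' (heap m).neighborSet t).ncard :=
    (Set.ncard_image_of_injective _ Fin.val_injective).symm
  have hsub : Fin.val '' (heap m).neighborSet t ⊆
      (({2 * t.val + 1, 2 * t.val + 2, (t.val - 1) / 2} : Finset ℕ) : Set ℕ) := by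
    rintro _ ⟨j, hj, rfl⟩
    have := heap_adj.1 hj
    simp
    omega
  rw [hinj]
  refine (Set.ncard_le_ncard hsub (Finset.finite_toSet _)).trans ?_
  rw [Set.ncard_coe_finset]
  exact Finset.card_le_three

theorem mem_leaves_heap {n : ℕ} {t : Fin (2 * n + 1)} :
    t ∈ leaves (heap (2 * n + 1)) ↔ n ≤ t.val := by
  change ((heap (2 * n + 1)).neighborSet t).ncard ≤ 1 ↔ _
  rw [Set.ncard_le_one]
  constructor
  · intro h
    by_contra! hlt
    have := h ⟨2 * t.val + 1, by omega⟩ (heap_adj.2 (by simp))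
      ⟨2 * t.val + 2, by omega⟩ (heap_adj.2 (by simp))
    simp at this
  · intro h i hi j hj
    have := heap_adj.1 hi
    have := heap_adj.1 hj
    exact Fin.ext (by omega)

theorem ncard_leaves_heap (n : ℕ) : (leaves (heap (2 * n + 1))).ncard = n + 1 := by
  have h : leaves (heap (2 * n + 1)) = Set.range
      fun i : Fin (n + 1) => (⟨n + i.val, by omega⟩ : Fin (2 * n + 1)) := by
    ext t
    rw [mem_leaves_heap]
    constructor
    · intro h
      exact ⟨⟨t.val - n, by omega⟩, Fin.ext (by simp; omega)⟩
    · rintro ⟨i, rfl⟩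
      simp
  rw [h, ← Set.image_univ, Set.ncard_image_of_injective, Set.ncard_univ, Nat.card_fin]
  intro i j hij
  simpa [Fin.ext_iff] using hij

theorem nonempty_branchDecomposition (V : Type*) [Finite V] [Nonempty V] :
    Nonempty (BranchDecomposition V) := by
  obtain ⟨n, hn⟩ := Nat.exists_eq_succ_of_ne_zero (Nat.card_pos (α := V)).ne'
  have hcard : Nat.card V = Nat.card (leaves (heap (2 * n + 1))) := by
    rw [hn, Nat.card_coe_set_eq, ncard_leaves_heap]
  exact ⟨⟨_, inferInstance, heap (2 * n + 1), heap_isTree _, heap_neighborSet_ncard_le, 0,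
    Classical.choice (Finite.card_eq.1 hcard)⟩⟩

/-- Existence matters here: over an empty set of decompositions the infimum would be 0 by default,
and no decomposition would attain it. -/
theorem exists_branchDecomposition_width_eq {V : Type*} [Finite V] [Nonempty V]
    (f : Set V → Set V → ℕ) : ∃ D : BranchDecomposition V, D.width f = branchWidth f := by
  obtain ⟨D⟩ := nonempty_branchDecomposition V
  exact Nat.sInf_mem (s := {k | ∃ D : BranchDecomposition V, D.width f = k}) ⟨_, D, rfl⟩

theorem BranchDecomposition.le_width {V : Type*} (D : BranchDecomposition V)
    (f : Set V → Set V → ℕ) (x : D.Node) : f (D.leafSet x) (D.leafSet x)ᶜ ≤ D.width f := by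
  have := D.finite_node
  exact le_ciSup (f := fun x => f (D.leafSet x) (D.leafSet x)ᶜ) (Set.finite_range _).bddAbove x

end Heap

end GraphWidth

theorem mainTheorem8 {V : Type*} [Finite V] (G : SimpleGraph V) (hG : G.IsBipartite) :
    GraphWidth.treewidth G ≤ 6 * GraphWidth.mimWidth (GraphWidth.gadget G) := by
  open GraphWidth in
  rcases isEmpty_or_nonempty V with hV | ⟨⟨v⟩⟩
  -- Every finite tree has a leaf, so an empty vertex set admits no branch decomposition; the
  -- one-node tree serves as layout instead.
  · have h := treewidth_le_of_layout (G := G) (T := (⊥ : SimpleGraph Unit)) (k := 0)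
      SimpleGraph.IsTree.of_subsingleton (fun t => by simp [SimpleGraph.neighborSet]) ()
      (Function.injective_of_subsingleton (fun _ : V => ())) fun x =>
        ⟨∅, ∅, ⟨fun v => isEmptyElim v, fun v => isEmptyElim v, fun v => isEmptyElim v⟩, by simp⟩
    exact h.trans (Nat.zero_le _)
  · obtain ⟨col⟩ := hG
    have : Nonempty (GadgetVertex G) := ⟨.x v⟩
    obtain ⟨D, hD⟩ := exists_branchDecomposition_width_eq
      fun X Y => maxInducedMatching ((gadget G).between X Y)
    have := D.finite_node
    have h := treewidth_le_of_layout (G := G) D.isTree D.subcubic D.root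
      (l := fun v => (D.leafEquiv (representative G col v) : D.Node))
      (k := 2 * mimWidth (gadget G))
      (Subtype.val_injective.comp (D.leafEquiv.injective.comp (representative_injective col)))
      fun x => by
        obtain ⟨A, B, hAB, hle⟩ := exists_isSeparation_le col (D.leafSet x)
        refine ⟨A, B, hAB, hle.trans (Nat.mul_le_mul_left 2 ?_)⟩
        rw [mimWidth, ← hD]
        exact D.le_width (fun X Y => maxInducedMatching ((gadget G).between X Y)) x
    omega
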